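/- Let $k$ be a field of characteristic zero, let $A$ be a commutative semisimple finite-dimensional $k$-algebra (that is, a finite product of finite field extensions of $k$), and let $\tau : A \to A$, $a \mapsto a^\tau$, be a $k$-algebra involution ($\tau = \mathrm{id}$ is allowed). Let $\epsilon \in \{1,-1\}$, and let $E$ be an $\epsilon$-Hermitian $A$-module, that is, a finitely generated $A$-module with a non-degenerate $k$-bilinear map $\langle\,,\rangle : E \times E \to A$ satisfying $\langle u, v\rangle = \epsilon \langle v, u\rangle^\tau$ and $\langle au, v\rangle = a\langle u, v\rangle$ for all $a \in A$ and $u, v \in E$. Let $\mathrm{U}(E)$ be the group of all $A$-module automorphisms of $E$ which preserve $\langle\,,\rangle$. Let $\breve{\mathrm{U}}(E)$, the MVW-extension of $\mathrm{U}(E)$, be the subgroup of $\mathrm{GL}_k(E) \times \{\pm 1\}$ consisting of all pairs $(g, \delta)$ such that either $\delta = 1$ and $\langle gu, gv\rangle = \langle u, v\rangle$ for all $u, v \in E$, or $\delta = -1$ and $\langle gu, gv\rangle = \langle v, u\rangle$ for all $u, v \in E$. View $\mathrm{U}(E)$ as a subgroup of $\breve{\mathrm{U}}(E)$ through $x \mapsto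 (x, 1)$. Then for every $x \in \mathrm{U}(E)$ there is an element $\breve g \in \breve{\mathrm{U}}(E) \setminus \mathrm{U}(E)$ such that $\breve g\, x\, \breve g^{-1} = x^{-1}$. -/

import Mathlib

namespace MVW

/-- An `ε`-Hermitian form on an `A`-module `E`, where `τ` is a `k`-algebra endomorphism of `A`
(in the theorem: an involution): a non-degenerate `k`-bilinear map `E × E → A`, `A`-linear in the
first variable, with `⟨u, v⟩ = ε ⟨v, u⟩^τ`. Together with finite generation of `E` (a separate
hypothesis) this is an `ε`-Hermitian `A`-module. -/
structure HermitianForm (k : Type*) {A : Type*} [Field k] [CommRing A] [Algebra k A]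
    (τ : A →ₐ[k] A) (ε : ℤˣ) (E : Type*) [AddCommGroup E] [Module k E] [Module A E] where
  form : E →ₗ[k] E →ₗ[k] A
  nondegenerate : form.Nondegenerate
  hermitian : ∀ u v : E, form u v = (ε : ℤ) • τ (form v u)
  smul_left : ∀ (a : A) (u v : E), form (a • u) v = a * form u v

namespace HermitianForm

variable {k A : Type*} [Field k] [CommRing A] [Algebra k A] {τ : A →ₐ[k] A} {ε : ℤˣ}
  {E : Type*} [AddCommGroup E] [Module k E] [Module A E]

/-- The classical group `U(E)`: all `A`-module automorphisms of `E` preserving the form. -/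
def unitaryGroup (B : HermitianForm k τ ε E) : Subgroup (E ≃ₗ[A] E) where
  carrier := {g | ∀ u v : E, B.form (g u) (g v) = B.form u v}
  mul_mem' := by
    intro a b ha hb u v
    rw [LinearEquiv.mul_apply, LinearEquiv.mul_apply, ha, hb]
  one_mem' := fun _ _ => rfl
  inv_mem' := by
    intro a ha u v
    rw [← ha (a⁻¹ u) (a⁻¹ v), ← LinearEquiv.mul_apply, ← LinearEquiv.mul_apply, mul_inv_cancel]
    rfl

/-- The MVW-extension of `U(E)`: the subgroup of `GL(E_k) × {±1}` of all pairs `(g, δ)` such that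
either `δ = 1` and `⟨g u, g v⟩ = ⟨u, v⟩`, or `δ = -1` and `⟨g u, g v⟩ = ⟨v, u⟩`. -/
def mvwExtension (B : HermitianForm k τ ε E) : Subgroup ((E ≃ₗ[k] E) × ℤˣ) where
  carrier := {p | (p.2 = 1 ∧ ∀ u v : E, B.form (p.1 u) (p.1 v) = B.form u v) ∨
    (p.2 = -1 ∧ ∀ u v : E, B.form (p.1 u) (p.1 v) = B.form v u)}
  mul_mem' := by
    rintro ⟨a, d⟩ ⟨b, e⟩ (⟨rfl, ha⟩ | ⟨rfl, ha⟩) (⟨rfl, hb⟩ | ⟨rfl, hb⟩)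
    · exact Or.inl ⟨by simp, fun u v => (ha _ _).trans (hb _ _)⟩
    · exact Or.inr ⟨by simp, fun u v => (ha _ _).trans (hb _ _)⟩
    · exact Or.inr ⟨by simp, fun u v => (ha _ _).trans (hb _ _)⟩
    · exact Or.inl ⟨by simp, fun u v => (ha _ _).trans (hb _ _)⟩
  one_mem' := Or.inl ⟨rfl, fun _ _ => rfl⟩
  inv_mem' := by
    rintro ⟨a, d⟩ (⟨rfl, ha⟩ | ⟨rfl, ha⟩)
    · refine Or.inl ⟨by simp, fun u v => ?_⟩
      have h := ha (a.symm u) (a.symm v)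
      simp only [LinearEquiv.apply_symm_apply] at h
      exact h.symm
    · refine Or.inr ⟨by simp, fun u v => ?_⟩
      have h := ha (a.symm v) (a.symm u)
      simp only [LinearEquiv.apply_symm_apply] at h
      exact h.symm

variable [IsScalarTower k A E]

/-- The inclusion `U(E) → Ŭ(E)`, `x ↦ (x, 1)`, through which `U(E)` is viewed as a subgroup of its
MVW-extension. -/
def toMVW (B : HermitianForm k τ ε E) : B.unitaryGroup →* B.mvwExtension where
  toFun x := ⟨((x : E ≃ₗ[A] E).restrictScalars k, 1), Or.inl ⟨rfl, x.2⟩⟩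
  map_one' := rfl
  map_mul' _ _ := by
    apply Subtype.ext
    exact Prod.ext rfl (one_mul 1).symm

end HermitianForm

end MVW

/-!
The element `x` makes `E` a module over `R = A[T;T⁻¹]`, with `T` acting as `x`. The ring `R` carries
the involution `σ` that extends `τ` and sends `T` to `T⁻¹`, and composing the form with the trace
of `A` over `k` gives a non-degenerate `ε`-symmetric `k`-bilinear form `b` on `E` with
`b (r • u) v = b u (σ r • v)`. What is needed is a `σ`-semilinear map `g` with
`b (g u) (g v) = b v u`: such a `g` satisfies `g ∘ x = x⁻¹ ∘ g`, and since the trace form of `A` is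
non-degenerate it also reverses the original form. Splitting off non-degenerate submodules, one may
assume that `E` has no proper non-zero ones, and one may replace `R` by the quotient `S` that acts
faithfully. Like `R`, the ring `S` is a principal ideal ring, because `A` is a product of fields.

By Fitting's lemma every `s : S` with `σ s = ± s` is then nilpotent or invertible
(`isNilpotent_or_isUnit_of_indecomposable`). Consequently the nilradical has a generator `p` with
`σ p = ± p` (`exists_generator_nilradical`), and if `p ^ n` is its last non-zero power, every
non-zero `σ`-stable ideal contains `p ^ n` (`pow_mem_of_stable`). There are two cases.

* If `b (s * p ^ n • w) w ≠ 0` for some `s` and `w`, the cyclic module `S w` is non-degenerate, so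
  `E = S w` is free on `w`, and `g (s • w) = σ s • w` works because `S` is commutative
  (`hasAntiIsometry_of_not_alternating`).
* Otherwise the form `b (p ^ n • u) v` is alternating. Then `σ` is the identity modulo `p`, the
  ring `S` is local, and vectors `w`, `z` with `b (p ^ n • w) z ≠ 0` can be corrected step by step
  until `b (s • w) w = b (s • z) z = 0` for all `s` (`exists_isotropic`). Then `E` is free on `w`,
  `z`, and `g (s • w + t • z) = σ s • w + σ t • c • z` works for a suitable `c : S`
  (`hasAntiIsometry_of_alternating`).
-/

namespace MVW

/-! ### Laurent polynomials over a semisimple commutative ring -/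

section Laurent

open Polynomial LaurentPolynomial

theorem isPrincipalIdealRing_polynomial (A : Type*) [CommRing A] [IsSemisimpleRing A] :
    IsPrincipalIdealRing A[X] := by
  have : IsReduced A := inferInstance
  have e := (Polynomial.mapEquiv (IsArtinianRing.equivPi A).toRingEquiv).trans
    (Polynomial.piEquiv fun I : MaximalSpectrum A => A ⧸ I.asIdeal)
  let _ (I : MaximalSpectrum A) : Field (A ⧸ I.asIdeal) := Ideal.Quotient.field _
  have : IsPrincipalIdealRing (∀ I : MaximalSpectrum A, (A ⧸ I.asIdeal)[X]) := inferInstance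
  exact IsPrincipalIdealRing.of_surjective e.symm e.symm.surjective

theorem isPrincipalIdealRing_laurentPolynomial (A : Type*) [CommRing A] [IsSemisimpleRing A] :
    IsPrincipalIdealRing A[T;T⁻¹] := by
  have := isPrincipalIdealRing_polynomial A
  refine ⟨fun I => ?_⟩
  rw [← IsLocalization.map_under (Submonoid.powers (X : A[X])) A[T;T⁻¹] I]
  exact Submodule.IsPrincipal.map_ringHom _ (IsPrincipalIdealRing.principal _)

end Laurent

/-! ### Rings with involution whose symmetric elements are nilpotent or invertible -/

section Involution

variable {S : Type*} [CommRing S] {σ : S →+* S}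

theorem isNilpotent_of_two_mul (h2 : IsUnit (2 : S)) {s : S} (h : IsNilpotent (2 * s)) :
    IsNilpotent s := by
  obtain ⟨n, hn⟩ := h
  exact ⟨n, by rwa [mul_pow, (h2.pow n).mul_right_eq_zero] at hn⟩

/-- If the (anti)symmetric elements are nilpotent or invertible, `S` modulo its nilradical has no
proper non-zero stable ideals. -/
theorem eq_top_or_forall_isNilpotent (hσ : Function.Involutive σ) (h2 : IsUnit (2 : S))
    (hloc : ∀ s, σ s = s ∨ σ s = -s → IsNilpotent s ∨ IsUnit s)
    (I : Ideal S) (hI : ∀ s ∈ I, σ s ∈ I) : I = ⊤ ∨ ∀ s ∈ I, IsNilpotent s := by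
  refine or_iff_not_imp_right.2 fun h => ?_
  push Not at h
  obtain ⟨s, hs, hsn⟩ := h
  rcases hloc (s + σ s) (by simp [hσ s, add_comm]) with hp | hp
  · rcases hloc (s - σ s) (by simp [hσ s]) with hm | hm
    · refine absurd (isNilpotent_of_two_mul h2 ?_) hsn
      have := (Commute.all (s + σ s) (s - σ s)).isNilpotent_add hp hm
      convert this using 1
      ring
    · exact Ideal.eq_top_of_isUnit_mem _ (I.sub_mem hs (hI s hs)) hm
  · exact Ideal.eq_top_of_isUnit_mem _ (I.add_mem hs (hI s hs)) hp

/-- Starting from any generator `a` of the nilradical, with `σ a = u * a`, one of `a ± σ a` is again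
a generator: the stable ideal of all `s` with `a + σ a ∣ s * a` contains `1 + u`, so if it is proper
then `1 + u` is nilpotent and `1 - u` is invertible. -/
theorem exists_generator_nilradical [IsPrincipalIdealRing S] (hσ : Function.Involutive σ)
    (h2 : IsUnit (2 : S))
    (hloc : ∀ s, σ s = s ∨ σ s = -s → IsNilpotent s ∨ IsUnit s) :
    ∃ p : S, (σ p = p ∨ σ p = -p) ∧ ∀ s, IsNilpotent s ↔ p ∣ s := by
  obtain ⟨a, ha⟩ := (IsPrincipalIdealRing.principal (nilradical S)).principal
  have ha' (s : S) : IsNilpotent s ↔ a ∣ s := by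
    rw [← mem_nilradical, ha]
    exact Ideal.mem_span_singleton
  obtain ⟨u, hu⟩ : a ∣ σ a := (ha' _).1 (((ha' a).2 dvd_rfl).map σ)
  obtain ⟨i2, hi2⟩ := h2.exists_right_inv
  have hau : a = σ u * σ a := by
    conv_lhs => rw [← hσ a, hu, map_mul, mul_comm]
  let K : Ideal S := (Ideal.span {a + σ a}).colon {a}
  have hK (s : S) : s ∈ K ↔ a + σ a ∣ s * a := by
    simp [K, Submodule.mem_colon_singleton, Ideal.mem_span_singleton]
  have hKσ : ∀ s ∈ K, σ s ∈ K := by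
    intro s hs
    rw [hK] at hs ⊢
    obtain ⟨r, hr⟩ := hs
    refine ⟨σ u * σ r, ?_⟩
    have hr' := congrArg σ hr
    simp only [map_mul, map_add, hσ a] at hr'
    linear_combination σ s * hau + σ u * hr'
  have key {c : S} (h : c ∣ a) (h' : a ∣ c) (s : S) : IsNilpotent s ↔ c ∣ s :=
    (ha' s).trans ⟨h.trans, h'.trans⟩
  rcases eq_top_or_forall_isNilpotent hσ h2 hloc K hKσ with h | h
  · refine ⟨a + σ a, Or.inl (by simp [hσ a, add_comm]), key ?_ ?_⟩
    · simpa using (hK 1).1 (h ▸ Submodule.mem_top)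
    · exact dvd_add dvd_rfl ⟨u, hu⟩
  · have hn : IsNilpotent (1 + u) := h _ ((hK _).2 ⟨1, by rw [hu]; ring⟩)
    have hun : IsUnit (1 - u) := by
      have : IsUnit (2 + -(1 + u)) :=
        hn.neg.isUnit_add_left_of_commute h2 (Commute.all _ _)
      convert this using 1
      ring
    refine ⟨a - σ a, Or.inr (by simp [hσ a]), key ?_ ?_⟩
    · obtain ⟨w, hw⟩ := hun.exists_right_inv
      exact ⟨w, by rw [hu]; linear_combination -a * hw⟩
    · exact dvd_sub dvd_rfl ⟨u, hu⟩

/-- If each colon ideal of `I` by a power of `p` is the unit ideal or consists of nilpotent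
elements, then a non-zero `I` is generated by a power of `p`, so it contains the last non-zero power. -/
theorem pow_mem_of_ne_bot {p : S} {n : ℕ} (hp : ∀ s, IsNilpotent s ↔ p ∣ s)
    (hn : p ^ (n + 1) = 0) (I : Ideal S)
    (hI : ∀ j, p ^ j ∈ I ∨ ∀ s, s * p ^ j ∈ I → IsNilpotent s) (hI0 : I ≠ ⊥) : p ^ n ∈ I := by
  by_contra hnI
  refine hI0 (eq_bot_iff.2 fun s hs => ?_)
  have (j : ℕ) (hj : j ≤ n + 1) : ∀ s ∈ I, p ^ j ∣ s := by
    induction j with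
    | zero => simp
    | succ j ih =>
      intro s hs
      obtain ⟨r, rfl⟩ := ih (by omega) s hs
      rcases hI j with h | h
      · exact absurd (I.mem_of_dvd (pow_dvd_pow p (by omega)) h) hnI
      · rw [pow_succ]
        exact mul_dvd_mul_left _ ((hp r).1 (h r (by rwa [mul_comm])))
  simpa [hn] using this (n + 1) le_rfl s hs

theorem pow_mem_of_stable (hσ : Function.Involutive σ) (h2 : IsUnit (2 : S))
    (hloc : ∀ s, σ s = s ∨ σ s = -s → IsNilpotent s ∨ IsUnit s)
    {p : S} {n : ℕ} (hpσ : σ p = p ∨ σ p = -p) (hp : ∀ s, IsNilpotent s ↔ p ∣ s)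
    (hn : p ^ (n + 1) = 0) (I : Ideal S) (hI : ∀ s ∈ I, σ s ∈ I) (hI0 : I ≠ ⊥) :
    p ^ n ∈ I := by
  refine pow_mem_of_ne_bot hp hn I (fun j => ?_) hI0
  let K : Ideal S := I.colon {p ^ j}
  have hK (s : S) : s ∈ K ↔ s * p ^ j ∈ I := by simp [K, Submodule.mem_colon_singleton]
  have hKσ : ∀ s ∈ K, σ s ∈ K := by
    intro s hs
    rw [hK] at hs ⊢
    have h := hI _ hs
    rw [map_mul, map_pow] at h
    rcases hpσ with h' | h'
    · rwa [h'] at h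
    · rw [h', neg_pow] at h
      have := I.mul_mem_left ((-1) ^ j) h
      convert this using 1
      rw [mul_left_comm, ← mul_assoc ((-1) ^ j), ← mul_pow]
      simp
  rcases eq_top_or_forall_isNilpotent hσ h2 hloc K hKσ with h | h
  · left
    simpa using (hK 1).1 (h ▸ Submodule.mem_top)
  · right
    exact fun s hs => h s ((hK s).2 hs)

theorem pow_mem_of_local {p : S} {n : ℕ} (hloc : ∀ s : S, IsNilpotent s ∨ IsUnit s)
    (hp : ∀ s, IsNilpotent s ↔ p ∣ s)
    (hn : p ^ (n + 1) = 0) (I : Ideal S) (hI0 : I ≠ ⊥) : p ^ n ∈ I := by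
  refine pow_mem_of_ne_bot hp hn I (fun j => ?_) hI0
  by_contra! h
  obtain ⟨h1, s, hs, hsn⟩ := h
  exact h1 ((Ideal.unit_mul_mem_iff_mem I ((hloc s).resolve_left hsn)).1 hs)

theorem pow_dvd_of_mul_eq_zero {p : S} {n : ℕ} (hloc : ∀ s : S, IsNilpotent s ∨ IsUnit s)
    (hp : ∀ s, IsNilpotent s ↔ p ∣ s) (hn : p ^ n ≠ 0) {c : S} (hc : p * c = 0) :
    p ^ n ∣ c := by
  have (j : ℕ) (hj : j ≤ n) : p ^ j ∣ c := by
    induction j with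
    | zero => simp
    | succ j ih =>
      obtain ⟨r, rfl⟩ := ih (by omega)
      rcases hloc r with h | h
      · rw [pow_succ]
        exact mul_dvd_mul_left _ ((hp r).1 h)
      · refine absurd ?_ hn
        rw [← mul_assoc, h.mul_left_eq_zero] at hc
        exact pow_eq_zero_of_le hj (by rwa [pow_succ'])
  exact this n le_rfl

end Involution

/-! ### Forms with adjoints given by an involution -/

section Form

variable {k S E : Type*} [Field k] [CommRing S] [Algebra k S] [AddCommGroup E] [Module k E]
  [Module S E]

/-- A non-degenerate `ε`-symmetric `k`-bilinear form on an `S`-module for which the adjoint of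
`s : S` is `σ s`. By symmetry it suffices to require non-degeneracy on the left. -/
structure IsSesquiForm (σ : S →ₐ[k] S) (ε : k) (b : E →ₗ[k] E →ₗ[k] k) : Prop where
  symm : ∀ u v, b u v = ε * b v u
  adjoint : ∀ (s : S) u v, b (s • u) v = b u (σ s • v)
  nondegenerate : ∀ u, (∀ v, b u v = 0) → u = 0

/-- There is a `σ`-semilinear map that reverses the form. Bijectivity is not required, as it is
automatic for a non-degenerate form in finite dimension. -/
def HasAntiIsometry (σ : S →ₐ[k] S) (b : E →ₗ[k] E →ₗ[k] k) : Prop :=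
  ∃ g : E →ₗ[k] E, (∀ (s : S) u, g (s • u) = σ s • g u) ∧ ∀ u v, b (g u) (g v) = b v u

namespace IsSesquiForm

variable {σ : S →ₐ[k] S} {ε : k} {b : E →ₗ[k] E →ₗ[k] k}

theorem adjoint' (hb : IsSesquiForm σ ε b) (hσ : Function.Involutive σ) (s : S) (u v : E) :
    b u (s • v) = b (σ s • u) v := by
  rw [hb.adjoint, hσ]

theorem eq_zero_of_forall_smul (hb : IsSesquiForm σ ε b) [FaithfulSMul S E] {s : S}
    (h : ∀ u v, b (s • u) v = 0) : s = 0 :=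
  FaithfulSMul.eq_of_smul_eq_smul (α := E) fun u => by
    rw [zero_smul, hb.nondegenerate _ (h u)]

variable [IsScalarTower k S E]

/-- If `E` is free on `w`, the map `s • w ↦ σ s • w` reverses the form. -/
theorem hasAntiIsometry_of_cyclic (hb : IsSesquiForm σ ε b) (hσ : Function.Involutive σ) (w : E)
    (hw : ∀ s : S, s • w = 0 → s = 0) (hs : ∀ u : E, ∃ s : S, s • w = u) :
    HasAntiIsometry σ b := by
  let f : S →ₗ[k] E := (LinearMap.toSpanSingleton S E w).restrictScalars k
  let e : S ≃ₗ[k] E := LinearEquiv.ofBijective f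
    ⟨(injective_iff_map_eq_zero f).2 hw, hs⟩
  let g : E →ₗ[k] E := f ∘ₗ σ.toLinearMap ∘ₗ e.symm.toLinearMap
  have hg (s : S) : g (s • w) = σ s • w :=
    congrArg (fun r => σ r • w) (e.symm_apply_apply s)
  refine ⟨g, fun s u => ?_, fun u v => ?_⟩
  · obtain ⟨t, rfl⟩ := hs u
    rw [← mul_smul, hg, hg, map_mul, mul_smul]
  · obtain ⟨s, rfl⟩ := hs u
    obtain ⟨t, rfl⟩ := hs v
    rw [hg, hg, hb.adjoint, hb.adjoint, hσ, ← mul_smul, ← mul_smul, mul_comm]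

/-- If `E` is free on `w`, `z`, both of which span isotropic submodules, then the map
`s • w + t • z ↦ σ s • w + σ t • c • z` reverses the form as soon as it does so on the pairings of
`w` with `z`. -/
theorem hasAntiIsometry_of_pair (hb : IsSesquiForm σ ε b) (hσ : Function.Involutive σ)
    (hε : ε * ε = 1) (w z : E)
    (hf : ∀ s t : S, s • w + t • z = 0 → s = 0 ∧ t = 0)
    (hs : ∀ u : E, ∃ s t : S, s • w + t • z = u)
    (hw : ∀ s : S, b (s • w) w = 0) (hz : ∀ s : S, b (s • z) z = 0)
    (c : S) (hc : ∀ s : S, b (σ s • w) (c • z) = ε * b (s • w) z) :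
    HasAntiIsometry σ b := by
  let f : (S × S) →ₗ[k] E := ((LinearMap.toSpanSingleton S E w).coprod
    (LinearMap.toSpanSingleton S E z)).restrictScalars k
  let e : (S × S) ≃ₗ[k] E := LinearEquiv.ofBijective f
    ⟨(injective_iff_map_eq_zero f).2 fun x hx => Prod.ext_iff.2 (hf x.1 x.2 hx),
      fun u => (hs u).elim fun s h => h.elim fun t h => ⟨(s, t), h⟩⟩
  have hww (s t : S) : b (s • w) (t • w) = 0 := by
    rw [hb.adjoint' hσ, ← mul_smul, hw]
  have hzz (s t : S) : b (s • z) (t • z) = 0 := by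
    rw [hb.adjoint' hσ, ← mul_smul, hz]
  have hwz (s t : S) : b (σ s • w) (σ t • c • z) = b (t • z) (s • w) := by
    rw [hb.adjoint' hσ, hσ, ← mul_smul, ← hσ t, ← map_mul, hc, hσ, mul_smul, ← hb.adjoint' hσ,
      hb.symm, ← mul_assoc, hε, one_mul]
  have hzw (s t : S) : b (σ t • c • z) (σ s • w) = b (s • w) (t • z) := by
    rw [hb.symm, hwz, ← hb.symm]
  let h : (S × S) →ₗ[k] E := ((LinearMap.toSpanSingleton S E w).coprod
    (LinearMap.toSpanSingleton S E (c • z))).restrictScalars k ∘ₗ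
      (σ.toLinearMap.prodMap σ.toLinearMap)
  let g : E →ₗ[k] E := h ∘ₗ e.symm.toLinearMap
  have hg (s t : S) : g (s • w + t • z) = σ s • w + σ t • c • z :=
    congrArg h (e.symm_apply_apply (s, t))
  refine ⟨g, fun s u => ?_, fun u v => ?_⟩
  · obtain ⟨x, y, rfl⟩ := hs u
    rw [smul_add, ← mul_smul, ← mul_smul, hg, hg, smul_add, map_mul, map_mul, mul_smul, mul_smul]
  · obtain ⟨x, y, rfl⟩ := hs u
    obtain ⟨x', y', rfl⟩ := hs v
    rw [hg, hg]
    simp only [map_add, LinearMap.add_apply, hww, hwz, hzw]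
    rw [smul_smul (σ y), smul_smul (σ y'), hzz, hzz]
    ring

end IsSesquiForm

end Form

/-! ### Indecomposable modules -/

namespace IsSesquiForm

variable {k S E : Type*} [Field k] [CommRing S] [AddCommGroup E] [Module k E] [Module S E]
  {b : E →ₗ[k] E →ₗ[k] k}

theorem polarization {p : S} {n : ℕ} (hq : ∀ s w, b ((s * p ^ n) • w) w = 0) (s : S) (u v : E) :
    b ((s * p ^ n) • u) v = -b ((s * p ^ n) • v) u := by
  have h := hq s (u + v)
  simp only [smul_add, map_add, LinearMap.add_apply, hq] at h
  linear_combination h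

/-- A non-zero `c` would have `p ^ n` among its multiples. -/
theorem eq_zero_of_forall_apply_eq_zero {p : S} {n : ℕ}
    (hloc : ∀ s : S, IsNilpotent s ∨ IsUnit s)
    (hp : ∀ s, IsNilpotent s ↔ p ∣ s) (hn : p ^ (n + 1) = 0) {w z : E}
    (hwz : b (p ^ n • w) z ≠ 0) {c : S} (hc : ∀ s : S, b ((s * c) • w) z = 0) : c = 0 := by
  by_contra h
  have := pow_mem_of_local hloc hp hn (Ideal.span {c}) (by simpa using h)
  obtain ⟨s, hs⟩ := Ideal.mem_span_singleton'.1 this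
  exact hwz (hs ▸ hc s)

variable [Algebra k S] {σ : S →ₐ[k] S} {ε : k}

section Alternating

variable {p : S} {n : ℕ} {δ : k}

theorem map_pow_of_eq_smul (hpσ : σ p = δ • p) (i : ℕ) : σ (p ^ i) = δ ^ i • p ^ i := by
  rw [map_pow, hpσ, smul_pow]

theorem exists_apply_ne_zero [FaithfulSMul S E] (hb : IsSesquiForm σ ε b) {s : S} (hs : s ≠ 0) :
    ∃ u v, b (s • u) v ≠ 0 := by
  by_contra! h
  exact hs (hb.eq_zero_of_forall_smul h)

variable [IsScalarTower k S E]

/-- The symmetry of the form `(u, v) ↦ b (s * p ^ i • u) v`. -/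
theorem smul_pow_swap (hb : IsSesquiForm σ ε b) (hσ : Function.Involutive σ)
    (hpσ : σ p = δ • p) (i : ℕ) (s : S) (u v : E) :
    b ((s * p ^ i) • u) v = ε * δ ^ i * b ((σ s * p ^ i) • v) u := by
  rw [hb.symm, hb.adjoint' hσ, map_mul, map_pow_of_eq_smul hpσ, mul_smul_comm, smul_assoc,
    map_smul, LinearMap.smul_apply, smul_eq_mul, mul_assoc]

/-- The functional `s ↦ b (s • w) z` does not vanish on the smallest non-zero ideal of `S`, so it
generates the dual of `S` as an `S`-module. -/
theorem exists_represent [Module.Finite k S] (hloc : ∀ s : S, IsNilpotent s ∨ IsUnit s)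
    (hp : ∀ s, IsNilpotent s ↔ p ∣ s) (hn : p ^ (n + 1) = 0) {w z : E}
    (hwz : b (p ^ n • w) z ≠ 0) (f : S →ₗ[k] k) : ∃ c : S, ∀ s, f s = b ((s * c) • w) z := by
  let l : S →ₗ[k] k := b.flip z ∘ₗ (LinearMap.toSpanSingleton S E w).restrictScalars k
  have hl (s : S) : l s = b (s • w) z := rfl
  let F : S →ₗ[k] Module.Dual k S := (LinearMap.mul k S).compr₂ l
  have hF (c s : S) : F c s = b ((s * c) • w) z := by
    rw [mul_comm]
    rfl
  have hinj : Function.Injective F := (injective_iff_map_eq_zero F).2 fun c hc =>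
    eq_zero_of_forall_apply_eq_zero hloc hp hn hwz fun s => by rw [← hF, hc]; rfl
  obtain ⟨c, hc⟩ := (LinearMap.injective_iff_surjective_of_finrank_eq_finrank
    (Subspace.dual_finrank_eq (K := k) (V := S)).symm).1 hinj f
  exact ⟨c, fun s => by rw [← hF, hc]⟩

variable [FaithfulSMul S E]

theorem sign_eq (hb : IsSesquiForm σ ε b) (hσ : Function.Involutive σ)
    (hpσ : σ p = δ • p) (hn0 : p ^ n ≠ 0) (hq : ∀ s w, b ((s * p ^ n) • w) w = 0) :
    ε * δ ^ n = -1 := by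
  obtain ⟨u, v, h⟩ := hb.exists_apply_ne_zero hn0
  have h1 := hb.smul_pow_swap hσ hpσ n 1 u v
  have h2 := polarization hq 1 u v
  simp only [map_one, one_mul] at h1 h2
  rw [h2] at h h1
  rw [neg_ne_zero] at h
  exact mul_right_cancel₀ h (by linear_combination -h1)

/-- In the alternating case `σ` is the identity modulo the annihilator of `p ^ n`. -/
theorem map_mul_pow (hb : IsSesquiForm σ ε b) (hσ : Function.Involutive σ)
    (hpσ : σ p = δ • p) (hn0 : p ^ n ≠ 0) (hq : ∀ s w, b ((s * p ^ n) • w) w = 0) (s : S) :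
    σ s * p ^ n = s * p ^ n := by
  rw [← sub_eq_zero]
  refine hb.eq_zero_of_forall_smul fun u v => ?_
  have h1 := hb.smul_pow_swap hσ hpσ n s u v
  rw [hb.sign_eq hσ hpσ hn0 hq] at h1
  rw [sub_smul, map_sub, LinearMap.sub_apply, polarization hq (σ s)]
  linear_combination -h1

theorem isNilpotent_map_sub (hb : IsSesquiForm σ ε b) (hσ : Function.Involutive σ)
    (hloc : ∀ s, σ s = s ∨ σ s = -s → IsNilpotent s ∨ IsUnit s)
    (hpσ : σ p = δ • p) (hn0 : p ^ n ≠ 0) (hq : ∀ s w, b ((s * p ^ n) • w) w = 0) (s : S) :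
    IsNilpotent (σ s - s) := by
  refine (hloc (σ s - s) (by simp [hσ s])).resolve_right fun h => hn0 ?_
  rw [← h.mul_right_eq_zero, sub_mul, hb.map_mul_pow hσ hpσ hn0 hq, sub_self]

theorem isNilpotent_or_isUnit_of_alternating [CharZero k] (hb : IsSesquiForm σ ε b)
    (hσ : Function.Involutive σ)
    (hloc : ∀ s, σ s = s ∨ σ s = -s → IsNilpotent s ∨ IsUnit s)
    (hpσ : σ p = δ • p) (hn0 : p ^ n ≠ 0) (hq : ∀ s w, b ((s * p ^ n) • w) w = 0) (s : S) :
    IsNilpotent s ∨ IsUnit s := by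
  have h2 : IsUnit (2 : S) := by
    simpa only [map_ofNat] using (IsUnit.mk0 (2 : k) two_ne_zero).map (algebraMap k S)
  have hs := hb.isNilpotent_map_sub hσ hloc hpσ hn0 hq s
  rcases hloc (s + σ s) (by simp [hσ s, add_comm]) with h | h
  · refine Or.inl (isNilpotent_of_two_mul h2 ?_)
    have := (Commute.all (s + σ s) (σ s - s)).isNilpotent_sub h hs
    convert this using 1
    ring
  · refine Or.inr ?_
    have := hs.neg.isUnit_add_left_of_commute h (Commute.all _ _)
    have h' : s + σ s + -(σ s - s) = 2 * s := by ring
    rw [h'] at this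
    exact isUnit_of_mul_isUnit_right this

/-- In the alternating case `w` can be modified, keeping its pairing with `z`, so that it spans an
isotropic submodule. Assume `b (s * p ^ (m + 1) • w) w = 0` for all `s`, and put `j = n - m`. If
`δ ^ j = 1` then symmetry already forces `b (s * p ^ m • w) w = 0`; if `δ ^ j = -1`, this holds
after adding to `w` a suitable multiple of `p ^ j • z`. -/
theorem exists_isotropic [CharZero k] [Module.Finite k S] (hb : IsSesquiForm σ ε b)
    (hσ : Function.Involutive σ)
    (hloc : ∀ s, σ s = s ∨ σ s = -s → IsNilpotent s ∨ IsUnit s)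
    (hδ : δ = 1 ∨ δ = -1)
    (hpσ : σ p = δ • p) (hp : ∀ s, IsNilpotent s ↔ p ∣ s) (hn0 : p ^ n ≠ 0)
    (hn : p ^ (n + 1) = 0) (hq : ∀ s w, b ((s * p ^ n) • w) w = 0) {w z : E}
    (hwz : b (p ^ n • w) z ≠ 0) :
    ∃ w', b (p ^ n • w') z ≠ 0 ∧ ∀ s : S, b (s • w') w' = 0 := by
  have hloc' := hb.isNilpotent_or_isUnit_of_alternating hσ hloc hpσ hn0 hq
  have hsign := hb.sign_eq hσ hpσ hn0 hq
  have hδ2 (i : ℕ) : δ ^ i = 1 ∨ δ ^ i = -1 := by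
    rcases hδ with rfl | rfl
    · simp
    · exact neg_one_pow_eq_or k i
  suffices H : ∀ i m, m + i = n →
      ∃ w', b (p ^ n • w') z ≠ 0 ∧ ∀ s : S, b ((s * p ^ m) • w') w' = 0 by
    simpa using H n 0 (zero_add n)
  intro i
  induction i with
  | zero =>
    rintro m rfl
    exact ⟨w, hwz, fun s => hq s w⟩
  | succ i ih =>
    rintro m hm
    obtain ⟨w, hwz, hw⟩ := ih (m + 1) (by omega)
    rcases hδ2 (i + 1) with hi | hi
    · refine ⟨w, hwz, fun s => ?_⟩
      have h1 := hb.smul_pow_swap hσ hpσ m s w w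
      obtain ⟨r, hr⟩ := (hp _).1 (hb.isNilpotent_map_sub hσ hloc hpσ hn0 hq s)
      have h2 : b ((σ s * p ^ m) • w) w = b ((s * p ^ m) • w) w := by
        rw [← sub_eq_zero, ← LinearMap.sub_apply, ← map_sub, ← sub_smul, ← hw r]
        congr 3
        linear_combination p ^ m * hr
      have h3 : ε * δ ^ m = -1 := by
        rw [← hsign, ← hm, pow_add, hi, mul_one]
      rw [h2, h3] at h1
      exact self_eq_neg.1 (by linear_combination h1)
      -- The functional to be cancelled is `2 • f`. It vanishes on multiples of `p`, so the element
      -- that represents `f` is a multiple of `p ^ n`; its cofactor `c` gives the correction.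
    · let f : S →ₗ[k] k := (2⁻¹ : k) • (b.flip w ∘ₗ
        (LinearMap.toSpanSingleton S E (p ^ m • w)).restrictScalars k)
      have hf (s : S) : b ((s * p ^ m) • w) w = 2 * f s := by
        have : f s = 2⁻¹ * b (s • p ^ m • w) w := rfl
        rw [this, mul_smul, mul_inv_cancel_left₀ two_ne_zero]
      obtain ⟨c₀, hc₀⟩ := exists_represent hloc' hp hn hwz f
      obtain ⟨c, rfl⟩ : p ^ n ∣ c₀ := by
        refine pow_dvd_of_mul_eq_zero hloc' hp hn0
          (eq_zero_of_forall_apply_eq_zero hloc' hp hn hwz fun s => ?_)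
        have h := hf (s * p)
        rw [mul_assoc, ← pow_succ', hw, hc₀] at h
        rw [← mul_assoc]
        exact (mul_eq_zero.1 h.symm).resolve_left two_ne_zero
      refine ⟨w + (c * p ^ (i + 1)) • z, ?_, fun s => ?_⟩
      · have : p ^ n * (c * p ^ (i + 1)) = 0 := by
          rw [pow_succ']
          linear_combination c * p ^ i * hn
        rwa [smul_add, ← mul_smul, this, zero_smul, add_zero]
      · have hpn : p ^ m * p ^ (i + 1) = p ^ n := by rw [← pow_add, hm]
        have hA : b ((s * p ^ m) • w) w = 2 * b ((s * c * p ^ n) • w) z := by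
          rw [hf, hc₀]
          congr 4
          ring
        have hB : b ((s * p ^ m) • w) ((c * p ^ (i + 1)) • z) = -b ((s * c * p ^ n) • w) z := by
          rw [hb.adjoint' hσ, ← mul_smul, map_mul, map_pow_of_eq_smul hpσ, hi, neg_one_smul]
          rw [← LinearMap.neg_apply, ← map_neg, ← neg_smul]
          congr 3
          linear_combination -s * hb.map_mul_pow hσ hpσ hn0 hq c - s * σ c * hpn
        have hC : b ((s * p ^ m) • (c * p ^ (i + 1)) • z) w = -b ((s * c * p ^ n) • w) z := by
          rw [← polarization hq, ← mul_smul]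
          congr 3
          linear_combination s * c * hpn
        have hD : b ((s * p ^ m) • (c * p ^ (i + 1)) • z) ((c * p ^ (i + 1)) • z) = 0 := by
          have : s * p ^ m * (c * p ^ (i + 1)) * p = 0 := by
            linear_combination s * c * p * hpn + s * c * hn
          rw [hb.adjoint' hσ, ← mul_smul, ← mul_smul, map_mul, map_pow_of_eq_smul hpσ, hi,
            neg_one_smul]
          have h0 : σ c * -p ^ (i + 1) * (s * p ^ m) * (c * p ^ (i + 1)) = 0 := by
            rw [pow_succ] at this ⊢
            linear_combination -σ c * p ^ i * this
          rw [h0, zero_smul, map_zero, LinearMap.zero_apply]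
        rw [smul_add, map_add, map_add, LinearMap.add_apply, LinearMap.add_apply, hA, hB, hC, hD]
        ring

end Alternating

variable [IsScalarTower k S E]

/-- Fitting's lemma: the kernel of a high power of `s` is orthogonal to its image when `σ s = ± s`,
so it is a non-degenerate submodule. -/
theorem isNilpotent_or_isUnit_of_indecomposable [Module.Finite k E] [FaithfulSMul S E]
    [Module.Finite k S]
    (hb : IsSesquiForm σ ε b) (hσ : Function.Involutive σ)
    (hind : ∀ W : Submodule S E, (∀ u ∈ W, (∀ v ∈ W, b u v = 0) → u = 0) → W = ⊥ ∨ W = ⊤)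
    (s : S) (hs : σ s = s ∨ σ s = -s) : IsNilpotent s ∨ IsUnit s := by
  have : IsNoetherian S E := isNoetherian_of_tower k inferInstance
  have : IsArtinian S E := isArtinian_of_tower k inferInstance
  have : IsArtinianRing S := IsArtinianRing.of_finite k S
  let f : E →ₗ[S] E := LinearMap.lsmul S E s
  have hf (N : ℕ) (u : E) : (f ^ N) u = s ^ N • u := by
    induction N with
    | zero => simp
    | succ N ih => rw [pow_succ', Module.End.mul_apply, ih, pow_succ', mul_smul]; rfl
  obtain ⟨N, hN, hN1⟩ := (f.eventually_isCompl_ker_pow_range_pow.and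
    (Filter.eventually_ge_atTop 1)).exists
  have hker : ∀ u ∈ LinearMap.ker (f ^ N), (∀ v ∈ LinearMap.ker (f ^ N), b u v = 0) → u = 0 := by
    intro u hu h
    refine hb.nondegenerate u fun v => ?_
    have hu' : s ^ N • u = 0 := by rw [← hf]; exact hu
    obtain ⟨x, hx, y, ⟨z, rfl⟩, rfl⟩ := Submodule.mem_sup.1
      (hN.sup_eq_top ▸ Submodule.mem_top (x := v))
    rw [map_add, h x hx, zero_add, hf, hb.adjoint' hσ, map_pow]
    rcases hs with hs | hs
    · rw [hs, hu', map_zero, LinearMap.zero_apply]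
    · rw [hs, neg_pow, mul_smul, hu', smul_zero, map_zero, LinearMap.zero_apply]
  rcases hind (LinearMap.ker (f ^ N)) hker with h | h
  · right
    refine IsArtinianRing.isUnit_of_mem_nonZeroDivisors ?_
    rw [mem_nonZeroDivisors_iff_left]
    intro t ht
    refine FaithfulSMul.eq_of_smul_eq_smul (α := E) fun u => ?_
    rw [zero_smul, ← Submodule.mem_bot S, ← h, LinearMap.mem_ker, hf, ← mul_smul,
      ← Nat.sub_add_cancel hN1, pow_succ, mul_assoc, ht, mul_zero, zero_smul]
  · refine Or.inl ⟨N, FaithfulSMul.eq_of_smul_eq_smul (α := E) fun u => ?_⟩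
    rw [← hf, zero_smul, ← LinearMap.mem_ker, h]
    trivial

theorem hasAntiIsometry_of_not_alternating (hb : IsSesquiForm σ ε b)
    (hσ : Function.Involutive σ)
    (hind : ∀ W : Submodule S E, (∀ u ∈ W, (∀ v ∈ W, b u v = 0) → u = 0) → W = ⊥ ∨ W = ⊤)
    {p : S} {n : ℕ}
    (hideal : ∀ I : Ideal S, (∀ s ∈ I, σ s ∈ I) → I ≠ ⊥ → p ^ n ∈ I)
    {s₀ : S} {w : E} (hw : b ((s₀ * p ^ n) • w) w ≠ 0) : HasAntiIsometry σ b := by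
  -- The `σ`-stable ideal of all `s` with `s • w` in the radical of the form on `S w`.
  let I : Ideal S :=
    { carrier := {s | ∀ t : S, b ((t * s) • w) w = 0}
      add_mem' := fun {x y} hx hy t => by
        rw [mul_add, add_smul, map_add, LinearMap.add_apply, hx, hy, add_zero]
      zero_mem' := fun t => by simp
      smul_mem' := fun c x hx t => by rw [smul_eq_mul, ← mul_assoc]; exact hx _ }
  have hI (s : S) : s ∈ I ↔ ∀ t : S, b ((t * s) • w) w = 0 := Iff.rfl
  have hI0 : I = ⊥ := by
    by_contra h
    refine hw ((hI _).1 (hideal I (fun s hs t => ?_) h) s₀)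
    rw [hb.symm, hb.adjoint' hσ, map_mul, hσ, hs, mul_zero]
  have hinj (s : S) (hs : ∀ t : S, b (s • w) (t • w) = 0) : s = 0 := by
    rw [← Submodule.mem_bot S, ← hI0, hI]
    intro t
    rw [mul_smul, hb.adjoint, hs]
  refine hb.hasAntiIsometry_of_cyclic hσ w (fun s hs => hinj s fun t => by simp [hs]) fun u => ?_
  have hW : Submodule.span S {w} = ⊤ := by
    refine (hind _ fun u hu h => ?_).resolve_left ?_
    · obtain ⟨s, rfl⟩ := Submodule.mem_span_singleton.1 hu
      rw [hinj s fun t => h _ (Submodule.mem_span_singleton.2 ⟨t, rfl⟩), zero_smul]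
    · rw [Submodule.span_singleton_eq_bot]
      rintro rfl
      simp at hw
  exact Submodule.mem_span_singleton.1 (hW ▸ Submodule.mem_top)

/-- The map of `hasAntiIsometry_of_pair` on an isotropic pair, where `c` comes from representing the
functional `s ↦ ε * b (σ s • w) z`. -/
theorem hasAntiIsometry_of_alternating [FaithfulSMul S E] [CharZero k] [Module.Finite k S]
    (hb : IsSesquiForm σ ε b) (hσ : Function.Involutive σ) (hε : ε * ε = 1)
    (hind : ∀ W : Submodule S E, (∀ u ∈ W, (∀ v ∈ W, b u v = 0) → u = 0) → W = ⊥ ∨ W = ⊤)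
    (hloc : ∀ s, σ s = s ∨ σ s = -s → IsNilpotent s ∨ IsUnit s)
    {p : S} {n : ℕ} {δ : k} (hδ : δ = 1 ∨ δ = -1)
    (hpσ : σ p = δ • p) (hp : ∀ s, IsNilpotent s ↔ p ∣ s) (hn0 : p ^ n ≠ 0)
    (hn : p ^ (n + 1) = 0) (hq : ∀ s w, b ((s * p ^ n) • w) w = 0) : HasAntiIsometry σ b := by
  have hloc' := hb.isNilpotent_or_isUnit_of_alternating hσ hloc hpσ hn0 hq
  have hswap {u v : E} (h : b (p ^ n • u) v ≠ 0) : b (p ^ n • v) u ≠ 0 := by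
    have := polarization hq 1 u v
    rw [one_mul] at this
    rwa [this, neg_ne_zero] at h
  obtain ⟨w₀, z₀, h₀⟩ := hb.exists_apply_ne_zero hn0
  obtain ⟨w, h₁, hw⟩ := hb.exists_isotropic hσ hloc hδ hpσ hp hn0 hn hq h₀
  obtain ⟨z, h₂, hz⟩ := hb.exists_isotropic hσ hloc hδ hpσ hp hn0 hn hq (hswap h₁)
  have hwz := hswap h₂
  have hww (s t : S) : b (s • w) (t • w) = 0 := by
    rw [hb.adjoint' hσ, ← mul_smul, hw]
  have hzz (s t : S) : b (s • z) (t • z) = 0 := by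
    rw [hb.adjoint' hσ, ← mul_smul, hz]
  have hnd (s t : S) (h : ∀ x y : S, b (s • w + t • z) (x • w + y • z) = 0) :
      s = 0 ∧ t = 0 := by
    simp only [map_add, LinearMap.add_apply, hww, hzz, zero_add, add_zero] at h
    constructor
    · refine eq_zero_of_forall_apply_eq_zero hloc' hp hn hwz fun x => ?_
      have := h 0 (σ x)
      rwa [zero_smul, map_zero, zero_add, ← hb.adjoint, ← mul_smul] at this
    · refine eq_zero_of_forall_apply_eq_zero hloc' hp hn h₂ fun x => ?_
      have := h (σ x) 0
      rwa [zero_smul, map_zero, add_zero, ← hb.adjoint, ← mul_smul] at this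
  have hW : Submodule.span S {w, z} = ⊤ := by
    refine (hind _ fun u hu h => ?_).resolve_left fun h => hn0 ?_
    · obtain ⟨s, t, rfl⟩ := Submodule.mem_span_pair.1 hu
      obtain ⟨rfl, rfl⟩ := hnd s t fun x y => h _ (Submodule.mem_span_pair.2 ⟨x, y, rfl⟩)
      simp
    · have hw0 : w = 0 := by
        rw [← Submodule.mem_bot S, ← h]
        exact Submodule.subset_span (by simp)
      simp [hw0] at hwz
  let f : S →ₗ[k] k := ε • (b.flip z ∘ₗ
    (LinearMap.toSpanSingleton S E w).restrictScalars k ∘ₗ σ.toLinearMap)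
  have hf (s : S) : f s = ε * b (σ s • w) z := rfl
  obtain ⟨c, hc⟩ := exists_represent hloc' hp hn hwz f
  refine hb.hasAntiIsometry_of_pair hσ hε w z (fun s t h => hnd s t fun x y => by simp [h])
    (fun u => Submodule.mem_span_pair.1 (hW ▸ Submodule.mem_top)) hw hz (σ c) fun s => ?_
  rw [hb.adjoint' hσ, hσ, ← mul_smul, mul_comm, ← hc, hf, hσ]

theorem hasAntiIsometry_of_indecomposable [Module.Finite k E] [FaithfulSMul S E] [CharZero k]
    [IsPrincipalIdealRing S] [Nontrivial E]
    (hb : IsSesquiForm σ ε b) (hσ : Function.Involutive σ) (hε : ε * ε = 1)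
    (hind : ∀ W : Submodule S E, (∀ u ∈ W, (∀ v ∈ W, b u v = 0) → u = 0) → W = ⊥ ∨ W = ⊤) :
    HasAntiIsometry σ b := by
  have : Module.Finite k S := by
    refine Module.Finite.of_injective (Algebra.lsmul k k E : S →ₐ[k] Module.End k E).toLinearMap ?_
    intro s t h
    exact FaithfulSMul.eq_of_smul_eq_smul (α := E) fun u => LinearMap.congr_fun h u
  have : Nontrivial S := Module.nontrivial S E
  have h2 : IsUnit (2 : S) := by
    simpa only [map_ofNat] using (IsUnit.mk0 (2 : k) two_ne_zero).map (algebraMap k S)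
  have hloc := hb.isNilpotent_or_isUnit_of_indecomposable hσ hind
  obtain ⟨p, hpσ, hp⟩ := exists_generator_nilradical (σ := σ.toRingHom) hσ h2 hloc
  obtain ⟨n, hn0, hn⟩ : ∃ n, p ^ n ≠ 0 ∧ p ^ (n + 1) = 0 := by
    have hex : ∃ n, p ^ (n + 1) = 0 := by
      obtain ⟨n, hn⟩ := (hp p).2 dvd_rfl
      exact ⟨n, by rw [pow_succ, hn, zero_mul]⟩
    classical
    refine ⟨Nat.find hex, ?_, Nat.find_spec hex⟩
    rcases h : Nat.find hex with _ | m
    · simp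
    · exact Nat.find_min hex (m := m) (by omega)
  by_cases hq : ∀ s w, b ((s * p ^ n) • w) w = 0
  · obtain ⟨δ, hδ, hpδ⟩ : ∃ δ : k, (δ = 1 ∨ δ = -1) ∧ σ p = δ • p := by
      rcases hpσ with h | h
      · exact ⟨1, Or.inl rfl, by simpa using h⟩
      · exact ⟨-1, Or.inr rfl, by simpa using h⟩
    exact hb.hasAntiIsometry_of_alternating hσ hε hind hloc hδ hpδ hp hn0 hn hq
  · push Not at hq
    obtain ⟨s, w, hw⟩ := hq
    exact hb.hasAntiIsometry_of_not_alternating hσ hind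
      (pow_mem_of_stable (σ := σ.toRingHom) hσ h2 hloc hpσ hp hn) hw

end IsSesquiForm

/-! ### Orthogonal splitting -/

namespace IsSesquiForm

variable {k R : Type*} [Field k] [CommRing R] [Algebra k R] {σ : R →ₐ[k] R} {ε : k}

section Splitting

variable {E : Type*} [AddCommGroup E] [Module k E] [Module R E] [IsScalarTower k R E]
  {b : E →ₗ[k] E →ₗ[k] k}

/-- The restriction of a `k`-bilinear form to an `R`-submodule. -/
def restrict (b : E →ₗ[k] E →ₗ[k] k) (W : Submodule R E) : W →ₗ[k] W →ₗ[k] k :=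
  b.compl₁₂ (W.subtype.restrictScalars k) (W.subtype.restrictScalars k)

@[simp]
theorem restrict_apply (W : Submodule R E) (u v : W) : restrict b W u v = b u v := rfl

theorem isSesquiForm_restrict (hb : IsSesquiForm σ ε b) {W : Submodule R E}
    (hW : ∀ u ∈ W, (∀ v ∈ W, b u v = 0) → u = 0) : IsSesquiForm σ ε (restrict b W) where
  symm u v := hb.symm u v
  adjoint s u v := hb.adjoint s u v
  nondegenerate u h := Subtype.ext (hW u u.2 fun v hv => h ⟨v, hv⟩)

/-- The orthogonal complement of an `R`-submodule, which is again an `R`-submodule because the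
adjoint of `r : R` is `σ r`. -/
def orthogonal (hb : IsSesquiForm σ ε b) (hσ : Function.Involutive σ) (W : Submodule R E) :
    Submodule R E where
  carrier := {v | ∀ u ∈ W, b u v = 0}
  add_mem' hx hy u hu := by rw [map_add, hx u hu, hy u hu, add_zero]
  zero_mem' u _ := map_zero _
  smul_mem' c v hv u hu := by rw [hb.adjoint' hσ, hv _ (W.smul_mem _ hu)]

theorem isCompl_orthogonal [Module.Finite k E] (hb : IsSesquiForm σ ε b)
    (hσ : Function.Involutive σ) {W : Submodule R E}
    (hW : ∀ u ∈ W, (∀ v ∈ W, b u v = 0) → u = 0) : IsCompl W (hb.orthogonal hσ W) := by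
  have hsymm {u v : E} (h : b u v = 0) : b v u = 0 := by rw [hb.symm, h, mul_zero]
  have hr : LinearMap.BilinForm.IsRefl b := fun u v h => hsymm h
  have h := (LinearMap.BilinForm.isCompl_orthogonal_iff_disjoint (B := b)
    (W := W.restrictScalars k) hr).2 ?_
  · refine ⟨disjoint_iff.2 ?_, codisjoint_iff.2 ?_⟩
    · rw [← Submodule.restrictScalars_inj k]
      exact h.inf_eq_bot
    · rw [← Submodule.restrictScalars_inj k, Submodule.restrictScalars_sup]
      exact h.sup_eq_top
  · rw [Submodule.disjoint_def]
    exact fun u hu h => hW u hu fun v hv => hsymm (h v hv)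

theorem hasAntiIsometry_of_isCompl {W W' : Submodule R E} (h : IsCompl W W')
    (h₁ : ∀ u ∈ W, ∀ v ∈ W', b u v = 0) (h₂ : ∀ u ∈ W, ∀ v ∈ W', b v u = 0)
    (hW : HasAntiIsometry σ (restrict b W)) (hW' : HasAntiIsometry σ (restrict b W')) :
    HasAntiIsometry σ b := by
  obtain ⟨g, hg, hgb⟩ := hW
  obtain ⟨g', hg', hgb'⟩ := hW'
  let e : (W × W') ≃ₗ[R] E := Submodule.prodEquivOfIsCompl W W' h
  let f : E →ₗ[k] E := (e.restrictScalars k).toLinearMap ∘ₗ g.prodMap g' ∘ₗ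
    (e.restrictScalars k).symm.toLinearMap
  have hf (u : W × W') : f (e u) = g u.1 + g' u.2 := by
    have : (e.restrictScalars k).symm (e u) = u := e.symm_apply_apply u
    simp only [f, LinearMap.comp_apply, LinearEquiv.coe_coe, this]
    rfl
  refine ⟨f, fun s u => ?_, fun u v => ?_⟩
  · obtain ⟨u, rfl⟩ := e.surjective u
    rw [← map_smul, hf, hf, smul_add, Prod.smul_fst, Prod.smul_snd, hg, hg']
    rfl
  · obtain ⟨u, rfl⟩ := e.surjective u
    obtain ⟨v, rfl⟩ := e.surjective v
    have hu (u : W × W') : e u = u.1 + u.2 := rfl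
    have h₃ := hgb u.1 v.1
    have h₄ := hgb' u.2 v.2
    rw [restrict_apply, restrict_apply] at h₃ h₄
    rw [hf, hf, hu, hu]
    simp only [map_add, LinearMap.add_apply]
    rw [h₁ _ (g u.1).2 _ (g' v.2).2, h₂ _ (g v.1).2 _ (g' u.2).2, h₁ _ v.1.2 _ u.2.2,
      h₂ _ u.1.2 _ v.2.2, h₃, h₄]

/-- The indecomposable case without faithfulness, by passing to the quotient of `R` by the
annihilator of `E`. -/
theorem hasAntiIsometry_of_forall_submodule [CharZero k] [IsPrincipalIdealRing R]
    [Module.Finite k E] [Nontrivial E] (hb : IsSesquiForm σ ε b) (hσ : Function.Involutive σ)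
    (hε : ε * ε = 1)
    (hind : ∀ W : Submodule R E, (∀ u ∈ W, (∀ v ∈ W, b u v = 0) → u = 0) → W = ⊥ ∨ W = ⊤) :
    HasAntiIsometry σ b := by
  let I := Module.annihilator R E
  let _ : Module (R ⧸ I) E := Module.quotientAnnihilator
  have hsmul (r : R) (u : E) : Ideal.Quotient.mk I r • u = r • u := rfl
  have : IsScalarTower k (R ⧸ I) E := ⟨fun c s u => by
    obtain ⟨r, rfl⟩ := Ideal.Quotient.mk_surjective s
    exact smul_assoc c r u⟩
  have : FaithfulSMul (R ⧸ I) E := ⟨fun {s t} h => by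
    obtain ⟨s, rfl⟩ := Ideal.Quotient.mk_surjective s
    obtain ⟨t, rfl⟩ := Ideal.Quotient.mk_surjective t
    refine Ideal.Quotient.eq.2 (Module.mem_annihilator.2 fun u => ?_)
    rw [sub_smul, sub_eq_zero]
    exact h u⟩
  have : IsPrincipalIdealRing (R ⧸ I) :=
    IsPrincipalIdealRing.of_surjective (Ideal.Quotient.mk I) Ideal.Quotient.mk_surjective
  have hI : I ≤ I.comap σ := by
    intro r hr
    refine Ideal.mem_comap.2 (Module.mem_annihilator.2 fun u => hb.nondegenerate _ fun v => ?_)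
    rw [hb.adjoint, hσ, Module.mem_annihilator.1 hr, map_zero]
  let σ' : (R ⧸ I) →ₐ[k] (R ⧸ I) := Ideal.quotientMapₐ I σ hI
  have hσ'mk (r : R) : σ' (Ideal.Quotient.mk I r) = Ideal.Quotient.mk I (σ r) := rfl
  have hσ' : Function.Involutive σ' := fun s => by
    obtain ⟨r, rfl⟩ := Ideal.Quotient.mk_surjective s
    rw [hσ'mk, hσ'mk, hσ]
  have hb' : IsSesquiForm σ' ε b :=
    { symm := hb.symm
      adjoint := fun s u v => by
        obtain ⟨r, rfl⟩ := Ideal.Quotient.mk_surjective s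
        exact hb.adjoint r u v
      nondegenerate := hb.nondegenerate }
  obtain ⟨g, hg, hgb⟩ := hb'.hasAntiIsometry_of_indecomposable hσ' hε fun W hW => by
    let W' : Submodule R E :=
      { W with smul_mem' := fun r u hu => W.smul_mem (Ideal.Quotient.mk I r) hu }
    have hmem (u : E) : u ∈ W' ↔ u ∈ W := Iff.rfl
    refine (hind W' hW).imp (fun h => ?_) fun h => ?_
    · ext u
      rw [← hmem, h, Submodule.mem_bot, Submodule.mem_bot]
    · ext u
      rw [← hmem, h]
      simp
  exact ⟨g, fun s u => hg (Ideal.Quotient.mk I s) u, hgb⟩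

end Splitting

theorem hasAntiIsometry [CharZero k] [IsPrincipalIdealRing R] (hσ : Function.Involutive σ)
    (hε : ε * ε = 1) {E : Type*} [AddCommGroup E] [Module k E] [Module R E]
    [IsScalarTower k R E] [Module.Finite k E] {b : E →ₗ[k] E →ₗ[k] k}
    (hb : IsSesquiForm σ ε b) : HasAntiIsometry σ b := by
  induction hd : Module.finrank k E using Nat.strong_induction_on generalizing E with
  | _ d ih =>
  subst hd
  cases subsingleton_or_nontrivial E
  · exact ⟨0, fun s u => Subsingleton.elim _ _, fun u v => by simp [Subsingleton.elim u 0]⟩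
  by_cases hind : ∀ W : Submodule R E,
      (∀ u ∈ W, (∀ v ∈ W, b u v = 0) → u = 0) → W = ⊥ ∨ W = ⊤
  · exact hb.hasAntiIsometry_of_forall_submodule hσ hε hind
  push Not at hind
  obtain ⟨W, hW, hbot, htop⟩ := hind
  have hc := hb.isCompl_orthogonal hσ hW
  have h₁ : ∀ u ∈ W, ∀ v ∈ hb.orthogonal hσ W, b u v = 0 := fun u hu v hv => hv u hu
  have h₂ : ∀ u ∈ W, ∀ v ∈ hb.orthogonal hσ W, b v u = 0 := fun u hu v hv => by
    rw [hb.symm, h₁ u hu v hv, mul_zero]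
  have hW' : ∀ u ∈ hb.orthogonal hσ W, (∀ v ∈ hb.orthogonal hσ W, b u v = 0) → u = 0 := by
    intro u hu h
    refine hb.nondegenerate u fun v => ?_
    obtain ⟨x, hx, y, hy, rfl⟩ := Submodule.mem_sup.1
      (hc.sup_eq_top ▸ Submodule.mem_top (x := v))
    rw [map_add, h₂ x hx u hu, h y hy, add_zero]
  have hlt {V : Submodule R E} (hV : V ≠ ⊤) : Module.finrank k V < Module.finrank k E :=
    Submodule.finrank_lt (s := V.restrictScalars k)
      (by rwa [Ne, Submodule.restrictScalars_eq_top_iff])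
  have hfin (V : Submodule R E) : Module.Finite k V :=
    inferInstanceAs (Module.Finite k (V.restrictScalars k))
  have htop' : hb.orthogonal hσ W ≠ ⊤ := by
    intro h
    rw [h] at hc
    exact hbot (eq_bot_iff.2 (by simpa using hc.disjoint.le_bot))
  exact hasAntiIsometry_of_isCompl hc h₁ h₂
    (ih _ (hlt htop) (hb.isSesquiForm_restrict hW) rfl)
    (ih _ (hlt htop') (hb.isSesquiForm_restrict hW') rfl)

end IsSesquiForm

/-! ### The involution and the action of Laurent polynomials -/

open LaurentPolynomial

section Laurent

variable {k A : Type*} [Field k] [CommRing A] [Algebra k A]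

/-- The endomorphism of `A[T;T⁻¹]` that acts as `τ` on the coefficients and inverts `T`. -/
noncomputable def laurentInvolution (τ : A →ₐ[k] A) : A[T;T⁻¹] →ₐ[k] A[T;T⁻¹] :=
  ((invert (R := A)).toAlgHom.restrictScalars k).comp (AddMonoidAlgebra.mapAlgHom ℤ τ)

theorem laurentInvolution_C_mul_T (τ : A →ₐ[k] A) (a : A) (n : ℤ) :
    laurentInvolution τ (C a * T n) = C (τ a) * T (-n) := by
  have h : AddMonoidAlgebra.mapAlgHom ℤ τ (C a * T n) = C (τ a) * T n := by
    rw [← single_eq_C_mul_T, ← single_eq_C_mul_T]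
    exact AddMonoidAlgebra.map_single ..
  change invert (AddMonoidAlgebra.mapAlgHom ℤ τ (C a * T n)) = _
  rw [h, map_mul, invert_C, invert_T]

theorem laurentInvolution_involutive {τ : A →ₐ[k] A} (hτ : Function.Involutive τ) :
    Function.Involutive (laurentInvolution τ) := by
  intro r
  induction r using LaurentPolynomial.induction_on' with
  | add p q hp hq => rw [map_add, map_add, hp, hq]
  | C_mul_T n a => rw [laurentInvolution_C_mul_T, laurentInvolution_C_mul_T, hτ, neg_neg]

variable {E : Type*} [AddCommGroup E] [Module A E]

/-- The action of `A[T;T⁻¹]` on `E` in which `T` acts as the automorphism `x`. -/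
noncomputable def laurentEval (x : E ≃ₗ[A] E) : A[T;T⁻¹] →ₐ[A] Module.End A E :=
  AddMonoidAlgebra.lift A (Module.End A E) ℤ
    ((LinearEquiv.automorphismGroup.toLinearMapMonoidHom (R := A) (M := E)).comp
      (zpowersHom (E ≃ₗ[A] E) x))

theorem laurentEval_C_mul_T (x : E ≃ₗ[A] E) (a : A) (n : ℤ) (u : E) :
    laurentEval x (C a * T n) u = a • (x ^ n) u := by
  rw [← single_eq_C_mul_T, laurentEval, AddMonoidAlgebra.lift_single]
  rfl

end Laurent

/-! ### The trace form of a Hermitian form -/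

/-- Non-degeneracy of the trace form of a reduced finite algebra in characteristic zero: some
multiple `y * a` is an idempotent with `a = a * (y * a)`, and an idempotent of trace zero
vanishes. -/
theorem eq_zero_of_forall_trace_mul_eq_zero {k A : Type*} [Field k] [CharZero k] [CommRing A]
    [Algebra k A] [Module.Finite k A] [IsReduced A] {a : A}
    (h : ∀ b, Algebra.trace k A (b * a) = 0) : a = 0 := by
  have : IsArtinianRing A := IsArtinianRing.of_finite k A
  obtain ⟨n, y, hy⟩ := IsArtinian.exists_pow_succ_smul_dvd a (1 : A)
  have hy : a ^ (n + 1) * y = a ^ n := by simpa using hy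
  have ha : a * (1 - y * a) = 0 := by
    refine IsReduced.eq_zero _ ⟨n + 1, ?_⟩
    have h0 : a ^ n * (1 - y * a) = 0 := by linear_combination -hy
    rw [mul_pow, pow_succ (1 - y * a)]
    linear_combination a * (1 - y * a) ^ n * h0
  have he : IsIdempotentElem (Algebra.lmul k A (y * a)) := by
    rw [IsIdempotentElem, ← map_mul]
    congr 1
    linear_combination -y * ha
  have hz := (LinearMap.IsIdempotentElem.trace_eq_zero_iff he).1 (h y)
  have hz1 : y * a = 0 := by simpa using LinearMap.congr_fun hz 1
  linear_combination ha + a * hz1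

namespace HermitianForm

variable {k A : Type*} [Field k] [CommRing A] [Algebra k A] {τ : A →ₐ[k] A} {ε : ℤˣ}
  {E : Type*} [AddCommGroup E] [Module k E] [Module A E]

theorem smul_right (B : HermitianForm k τ ε E) (a : A) (u v : E) :
    B.form u (a • v) = τ a * B.form u v := by
  rw [B.hermitian, B.smul_left, map_mul, ← mul_smul_comm, ← B.hermitian]

/-- The `k`-valued form obtained by composing with the trace of `A` over `k`. -/
noncomputable def traceForm (B : HermitianForm k τ ε E) : E →ₗ[k] E →ₗ[k] k :=
  B.form.compr₂ (Algebra.trace k A)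

theorem traceForm_apply (B : HermitianForm k τ ε E) (u v : E) :
    B.traceForm u v = Algebra.trace k A (B.form u v) := rfl

theorem trace_map_involution (hτ : Function.Involutive τ) (a : A) :
    Algebra.trace k A (τ a) = Algebra.trace k A a :=
  Algebra.trace_eq_of_algEquiv (AlgEquiv.ofAlgHom τ τ (AlgHom.ext hτ) (AlgHom.ext hτ)) a

theorem traceForm_symm (B : HermitianForm k τ ε E) (hτ : Function.Involutive τ) (u v : E) :
    B.traceForm u v = ((ε : ℤ) : k) * B.traceForm v u := by
  rw [traceForm_apply, B.hermitian, map_zsmul, trace_map_involution hτ, traceForm_apply,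
    zsmul_eq_mul]

theorem form_zpow_apply {B : HermitianForm k τ ε E} (x : B.unitaryGroup) (n : ℤ) (u v : E) :
    B.form (((x : E ≃ₗ[A] E) ^ n) u) v = B.form u (((x : E ≃ₗ[A] E) ^ (-n)) v) := by
  have h := (x ^ n).2 u (((x : E ≃ₗ[A] E) ^ (-n)) v)
  rw [← h]
  have h2 : ((x : E ≃ₗ[A] E) ^ n) (((x : E ≃ₗ[A] E) ^ (-n)) v) = v := by
    rw [← LinearEquiv.mul_apply, ← zpow_add, add_neg_cancel, zpow_zero]
    rfl
  rw [Subgroup.coe_zpow, h2]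

theorem eq_of_forall_trace_mul_eq [CharZero k] [Module.Finite k A] [IsReduced A]
    {a c : A} (h : ∀ r, Algebra.trace k A (r * a) = Algebra.trace k A (r * c)) : a = c := by
  rw [← sub_eq_zero]
  refine eq_zero_of_forall_trace_mul_eq_zero (k := k) fun r => ?_
  rw [mul_sub, map_sub, h, sub_self]

/-- The form is reversed by some `k`-linear automorphism that conjugates `x` to its inverse. -/
theorem exists_antiIsometry [CharZero k] [Module.Finite k A] [IsSemisimpleRing A]
    [IsScalarTower k A E] [Module.Finite A E]
    (B : HermitianForm k τ ε E) (hτ : Function.Involutive τ) (x : B.unitaryGroup) :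
    ∃ g : E ≃ₗ[k] E, (∀ u v, B.form (g u) (g v) = B.form v u) ∧
      ∀ u, g ((x : E ≃ₗ[A] E) u) = (x : E ≃ₗ[A] E)⁻¹ (g u) := by
  have : Module.Finite k E := Module.Finite.trans A E
  have : IsPrincipalIdealRing A[T;T⁻¹] := isPrincipalIdealRing_laurentPolynomial A
  let _ : Module A[T;T⁻¹] E := Module.compHom E (laurentEval (x : E ≃ₗ[A] E)).toRingHom
  have hsmul (a : A) (n : ℤ) (u : E) :
      (C a * T n : A[T;T⁻¹]) • u = a • ((x : E ≃ₗ[A] E) ^ n) u := laurentEval_C_mul_T _ _ _ _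
  have : IsScalarTower k A[T;T⁻¹] E := ⟨fun c r u => by
    have h : laurentEval (x : E ≃ₗ[A] E) (c • r) = c • laurentEval (x : E ≃ₗ[A] E) r :=
      map_smul ((laurentEval (x : E ≃ₗ[A] E)).restrictScalars k) c r
    exact LinearMap.congr_fun h u⟩
  have hb : IsSesquiForm (laurentInvolution τ) ((ε : ℤ) : k) B.traceForm :=
    { symm := B.traceForm_symm hτ
      adjoint := fun r u v => by
        induction r using LaurentPolynomial.induction_on' with
        | add p q hp hq => rw [add_smul, map_add, LinearMap.add_apply, hp, hq, map_add, add_smul,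
            map_add]
        | C_mul_T n a =>
          rw [laurentInvolution_C_mul_T, hsmul, hsmul, traceForm_apply, traceForm_apply,
            B.smul_left, B.smul_right, hτ, form_zpow_apply]
      nondegenerate := fun u h => B.nondegenerate.1 u fun v =>
        eq_of_forall_trace_mul_eq (k := k) fun r => by
          rw [mul_zero, map_zero, ← hτ r, ← B.smul_right]
          exact h _ }
  have hε : ((ε : ℤ) : k) * ((ε : ℤ) : k) = 1 := by
    rw [← Int.cast_mul, ← Units.val_mul, Int.units_mul_self, Units.val_one, Int.cast_one]
  obtain ⟨g, hg, hgb⟩ := hb.hasAntiIsometry (laurentInvolution_involutive hτ) hε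
  have hgA (a : A) (u : E) : g (a • u) = τ a • g u := by
    have h := hg (C a * T 0) u
    rw [laurentInvolution_C_mul_T, hsmul, hsmul] at h
    simpa using h
  have hinj : Function.Injective g := (injective_iff_map_eq_zero g).2 fun u hu =>
    hb.nondegenerate u fun v => by rw [← hgb, hu, map_zero]
  refine ⟨LinearEquiv.ofInjectiveEndo g hinj, fun u v => ?_, fun u => ?_⟩
  · refine eq_of_forall_trace_mul_eq (k := k) fun r => ?_
    rw [LinearEquiv.coe_ofInjectiveEndo, ← B.smul_left, ← B.smul_left, ← hτ r, ← hgA, hτ]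
    rw [← traceForm_apply, hgb, traceForm_apply, B.smul_right, hτ, B.smul_left]
  · have h := hg (C 1 * T 1) u
    rw [laurentInvolution_C_mul_T, hsmul, hsmul] at h
    simpa using h

end HermitianForm

end MVW

theorem theorem2p1 {k A E : Type*} [Field k] [CharZero k]
    [CommRing A] [Algebra k A] [Module.Finite k A] [IsSemisimpleRing A]
    (τ : A →ₐ[k] A) (hτ : Function.Involutive τ) (ε : ℤˣ)
    [AddCommGroup E] [Module k E] [Module A E] [IsScalarTower k A E] [Module.Finite A E]
    (B : MVW.HermitianForm k τ ε E) (x : B.unitaryGroup) :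
    ∃ g : B.mvwExtension, g ∉ B.toMVW.range ∧
      g * B.toMVW x * g⁻¹ = (B.toMVW x)⁻¹ := by
  obtain ⟨g, hgB, hgx⟩ := B.exists_antiIsometry hτ x
  refine ⟨⟨(g, -1), Or.inr ⟨rfl, hgB⟩⟩, ?_, ?_⟩
  · rintro ⟨y, hy⟩
    have h : (1 : ℤˣ) = -1 := congrArg (fun p => p.1.2) hy
    exact absurd h (by decide)
  · rw [mul_inv_eq_iff_eq_mul]
    apply Subtype.ext
    refine Prod.ext (LinearEquiv.ext hgx) ?_
    change (-1 : ℤˣ) * 1 = 1⁻¹ * -1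
    simp
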